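/- Let $n_1,n_2\ge 1$ and $d_1,d_2\ge 2$ be integers, and let $F(\mathbf x;\mathbf y)\in\mathbb C[x_1,\ldots,x_{n_1},y_1,\ldots,y_{n_2}]$ be a nonzero bihomogeneous polynomial of bidegree $(d_1,d_2)$, that is, every monomial of $F$ has degree $d_1$ in $\mathbf x$ and degree $d_2$ in $\mathbf y$. Let $X\subset\mathbb P_{\mathbb C}^{n_1-1}\times\mathbb P_{\mathbb C}^{n_2-1}$ be the closed subscheme given by $F(\mathbf x;\mathbf y)=0$, and assume that $X$ is smooth over $\mathbb C$. Let $V_1^*,V_2^*\subset\mathbb A_{\mathbb C}^{n_1+n_2}$ be the affine varieties given by $$V_1^*:\ \operatorname{rank}\left(\frac{\partial F(\mathbf x;\mathbf y)}{\partial x_j}\right)_{1\le j\le n_1}<1,\qquad V_2^*:\ \operatorname{rank}\left(\frac{\partial F(\mathbf x;\mathbf y)}{\partial y_j}\right)_{1\le j\le n_2}<1,$$ that is, by the vanishing of all partial derivatives of $F$ with respect to the $x_j$, respectively with respect to the $y_j$. Then $$\dim V_i^*\le\max\{n_1,\,n_2,\,n_1+n_2-n_i+1\}\qquad (i=1,2).$$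 -/

import Mathlib

noncomputable section

/-- Polynomials in the two groups of variables `x_1, …, x_{n₁}` (indices `Sum.inl`) and
`y_1, …, y_{n₂}` (indices `Sum.inr`), with complex coefficients. -/
abbrev BiPoly (n₁ n₂ : ℕ) : Type := MvPolynomial (Fin n₁ ⊕ Fin n₂) ℂ

/-- `F` is bihomogeneous of bidegree `(d₁, d₂)`: every monomial of `F` has total degree `d₁` in
the `x`-variables and total degree `d₂` in the `y`-variables. -/
def IsBihomogeneous {n₁ n₂ : ℕ} (F : BiPoly n₁ n₂) (d₁ d₂ : ℕ) : Prop :=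
  F.IsWeightedHomogeneous
    (Sum.elim (fun _ => ((1, 0) : ℕ × ℕ)) (fun _ => ((0, 1) : ℕ × ℕ))) (d₁, d₂)

/-- Coordinates on the standard affine open `{x_i ≠ 0, y_j ≠ 0} ≅ 𝔸^{n₁-1} × 𝔸^{n₂-1}` of
`ℙ^{n₁-1} × ℙ^{n₂-1}`. -/
abbrev ChartIndex {n₁ n₂ : ℕ} (i : Fin n₁) (j : Fin n₂) : Type :=
  {k : Fin n₁ // k ≠ i} ⊕ {l : Fin n₂ // l ≠ j}

/-- Dehomogenization: substitute `x_i = 1` and `y_j = 1`, keeping the other variables. -/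
def dehomogenize {n₁ n₂ : ℕ} (i : Fin n₁) (j : Fin n₂) :
    BiPoly n₁ n₂ →ₐ[ℂ] MvPolynomial (ChartIndex i j) ℂ :=
  MvPolynomial.aeval (Sum.elim
    (fun k => if h : k = i then 1 else MvPolynomial.X (Sum.inl ⟨k, h⟩))
    (fun l => if h : l = j then 1 else MvPolynomial.X (Sum.inr ⟨l, h⟩)))

/-- The coordinate ring of the affine open `{x_i ≠ 0, y_j ≠ 0}` of the closed subscheme `X` of
`ℙ^{n₁-1} × ℙ^{n₂-1}` given by the bihomogeneous equation `F = 0`. -/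
abbrev ChartRing {n₁ n₂ : ℕ} (F : BiPoly n₁ n₂) (i : Fin n₁) (j : Fin n₂) : Type :=
  MvPolynomial (ChartIndex i j) ℂ ⧸ Ideal.span {dehomogenize i j F}

/-- The subscheme `X` of `ℙ^{n₁-1} × ℙ^{n₂-1}` given by the bihomogeneous equation `F = 0` is
smooth over `ℂ`. Smoothness is local on `X`, and `X` is covered by its standard affine opens. -/
def IsSmoothBiprojective {n₁ n₂ : ℕ} (F : BiPoly n₁ n₂) : Prop :=
  ∀ (i : Fin n₁) (j : Fin n₂), Algebra.Smooth ℂ (ChartRing F i j)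

/-- The locus in `𝔸^{n₁+n₂}` where the Jacobian matrix of `F_1, …, F_R` with respect to the
`x`-variables has rank less than `R`. -/
def V₁star {n₁ n₂ R : ℕ} (F : Fin R → BiPoly n₁ n₂) : Set (Fin n₁ ⊕ Fin n₂ → ℂ) :=
  {z | (Matrix.of fun (i : Fin R) (j : Fin n₁) =>
    MvPolynomial.eval z (MvPolynomial.pderiv (Sum.inl j) (F i))).rank < R}

/-- The locus in `𝔸^{n₁+n₂}` where the Jacobian matrix of `F_1, …, F_R` with respect to the
`y`-variables has rank less than `R`. -/
def V₂star {n₁ n₂ R : ℕ} (F : Fin R → BiPoly n₁ n₂) : Set (Fin n₁ ⊕ Fin n₂ → ℂ) :=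
  {z | (Matrix.of fun (i : Fin R) (j : Fin n₂) =>
    MvPolynomial.eval z (MvPolynomial.pderiv (Sum.inr j) (F i))).rank < R}

/-- The dimension of an affine variety `V ⊆ 𝔸^σ` over `ℂ`, as the Krull dimension of its
coordinate ring `ℂ[σ] / I(V)`. -/
def affineDim {σ : Type} (V : Set (σ → ℂ)) : WithBot ℕ∞ :=
  ringKrullDim (MvPolynomial σ ℂ ⧸ MvPolynomial.vanishingIdeal ℂ V)

end

/-! At a common zero of all partials of `F`, Euler's identity gives `F = 0`; if also `x ≠ 0` and `y
≠ 0`, the point yields a singular point of `X` in an affine chart. So `V₁*` and `V₂*` meet only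
where `x = 0` or `y = 0`.

For `V₁*`, take a prime `P` containing its vanishing ideal, with domain quotient `Q`. If all `x_i`
or all `y_j` vanish in `Q`, then `dim Q` is at most `n₂` or `n₁`. Otherwise cut by the `n₂` forms
`∂F/∂y_j`, of bidegree `e = (d₁, d₂ - 1)`. By the Nullstellensatz every `x_i y_j` is nilpotent
modulo all the partials, so forms of bidegree `e` become integral over the algebra generated by
these `n₂` forms (`isIntegral_of_bihomogeneous`). Adjoining one nonzero `x_{i₀}` makes every
variable algebraic, hence `dim Q ≤ n₂ + 1`. The case of `V₂*` is symmetric; `d₁, d₂ ≥ 2` keeps the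
bidegrees positive. -/

/-! ### Krull dimension and transcendence degree -/

open MvPolynomial in
/-- A domain that is algebraic over the subalgebra generated by `m` elements has dimension at
most `m`. -/
theorem ringKrullDim_le_of_isAlgebraic_adjoin {σ Q : Type} [Finite σ] [CommRing Q] [IsDomain Q]
    [Algebra ℂ Q] (π : MvPolynomial σ ℂ →ₐ[ℂ] Q) (hπ : Function.Surjective π) {m : ℕ} {ι : Type}
    [Fintype ι] (hm : Fintype.card ι ≤ m) (v : ι → Q)
    (halg : ∀ i, IsAlgebraic (Algebra.adjoin ℂ (Set.range v)) (π (X i))) :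
    ringKrullDim Q ≤ (m : WithBot ℕ∞) := by
  have hft : Algebra.FiniteType ℂ Q := Algebra.FiniteType.of_surjective π hπ
  obtain ⟨s, g, hg, hgi⟩ := exists_integral_inj_algHom_of_fg ℂ Q
  have hclosure : ∀ p, IsAlgebraic (Algebra.adjoin ℂ (Set.range v)) (π p) := by
    intro p
    induction p using MvPolynomial.induction_on with
    | C a =>
      rw [← MvPolynomial.algebraMap_eq, AlgHom.commutes]
      exact isAlgebraic_algebraMap (A := Q) (algebraMap ℂ (Algebra.adjoin ℂ (Set.range v)) a)
    | add p q hp hq => rw [map_add]; exact hp.add hq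
    | mul_X p i hp => rw [map_mul]; exact hp.mul (halg i)
  have hA : Algebra.IsAlgebraic (Algebra.adjoin ℂ (Set.range v)) Q := by
    refine ⟨fun x => ?_⟩
    obtain ⟨p, rfl⟩ := hπ x
    exact hclosure p
  have h1 : Algebra.trdeg ℂ Q ≤ (m : Cardinal) :=
    (Algebra.IsAlgebraic.trdeg_le_cardinalMk ℂ (Set.range v)).trans
      (Cardinal.mk_range_le.trans (by rw [Cardinal.mk_fintype]; exact_mod_cast hm))
  have h2 : ((s : ℕ) : Cardinal) ≤ Algebra.trdeg ℂ Q := by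
    have := trdeg_le_of_injective g hg
    simpa using this
  have hsm : s ≤ m := by exact_mod_cast h2.trans h1
  -- Incomparability: contraction along the integral Noether normalization is strictly monotone on
  -- primes.
  have h3 : ringKrullDim Q ≤ ringKrullDim (MvPolynomial (Fin s) ℂ) := by
    refine Order.krullDim_le_of_strictMono (PrimeSpectrum.comap g.toRingHom) ?_
    intro p q hpq
    algebraize [g.toRingHom]
    have hint : Algebra.IsIntegral (MvPolynomial (Fin s) ℂ) Q := ⟨hgi⟩
    have := p.2
    exact Ideal.IsIntegral.comap_lt_comap (R := MvPolynomial (Fin s) ℂ) (I := p.asIdeal)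
      (J := q.asIdeal) hpq
  refine h3.trans ?_
  rw [MvPolynomial.ringKrullDim_of_isNoetherianRing]
  simp only [ringKrullDim_eq_zero_of_field, Nat.card_eq_fintype_card, Fintype.card_fin, zero_add]
  exact_mod_cast hsm

/-- The dimension of a quotient ring is bounded by that of its quotients by primes. -/
theorem ringKrullDim_quotient_le_of_forall_isPrime {R : Type} [CommRing R] (I : Ideal R)
    (m : WithBot ℕ∞)
    (h : ∀ P : Ideal R, P.IsPrime → I ≤ P → ringKrullDim (R ⧸ P) ≤ m) :
    ringKrullDim (R ⧸ I) ≤ m := by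
  rw [ringKrullDim_quotient]
  refine iSup_le fun l => ?_
  have hP := l.head.1.2
  have hle := h l.head.1.asIdeal hP l.head.2
  rw [ringKrullDim_quotient] at hle
  refine le_trans ?_ hle
  -- A chain of primes above `I` lies entirely above its smallest member, which serves as `P`.
  let f : Fin (l.length + 1) → PrimeSpectrum.zeroLocus (R := R) (l.head.1.asIdeal : Set R) :=
    fun i => ⟨(l i).1, show l.head.1 ≤ (l i).1 from
      (LTSeries.head_le l i : l.head ≤ l i)⟩
  exact le_iSup_of_le (f := fun p : LTSeries _ => ((p.length : ℕ∞) : WithBot ℕ∞))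
    { length := l.length, toFun := f, step := fun i => l.step i } le_rfl

/-! ### Jacobian criterion -/

open MvPolynomial in
/-- Jacobian criterion for hypersurfaces. -/
theorem exists_eval_pderiv_ne_zero_of_smooth {σ : Type} [Fintype σ] (f : MvPolynomial σ ℂ)
    (hf : f ≠ 0) [Algebra.Smooth ℂ (MvPolynomial σ ℂ ⧸ Ideal.span {f})] (z : σ → ℂ)
    (hz : eval z f = 0) : ∃ k, eval z (pderiv k f) ≠ 0 := by
  classical
  by_contra! hcon
  -- Formal smoothness lifts the identity of `ℂ[σ]/(f)` through the square-zero extension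
  -- `ℂ[σ]/(f²)`.
  let B := MvPolynomial σ ℂ ⧸ Ideal.span {f ^ 2}
  let I : Ideal B := Ideal.span {Ideal.Quotient.mk _ f}
  have hI : I ^ 2 = ⊥ := by
    rw [Ideal.span_singleton_pow, ← map_pow, Ideal.span_singleton_eq_bot,
      Ideal.Quotient.eq_zero_iff_mem]
    exact Ideal.mem_span_singleton_self _
  let q : MvPolynomial σ ℂ →ₐ[ℂ] B := Ideal.Quotient.mkₐ ℂ _
  let g : (MvPolynomial σ ℂ ⧸ Ideal.span {f}) →ₐ[ℂ] B ⧸ I :=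
    Ideal.Quotient.liftₐ _ ((Ideal.Quotient.mkₐ ℂ I).comp q) (by
      intro a ha
      obtain ⟨c, rfl⟩ := Ideal.mem_span_singleton'.mp ha
      rw [map_mul]
      have : ((Ideal.Quotient.mkₐ ℂ I).comp q) f = 0 :=
        Ideal.Quotient.eq_zero_iff_mem.mpr (Ideal.mem_span_singleton_self _)
      rw [this]; exact mul_zero (M₀ := B ⧸ I) _)
  obtain ⟨s, hs⟩ := Algebra.FormallySmooth.comp_surjective ℂ _ I hI g
  let t : MvPolynomial σ ℂ →ₐ[ℂ] B := s.comp (Ideal.Quotient.mkₐ ℂ _)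
  have ht : ∀ p, Ideal.Quotient.mk I (t p) = Ideal.Quotient.mk I (q p) := fun p =>
    DFunLike.congr_fun hs (Ideal.Quotient.mk _ p)
  have htf : t f = 0 := by
    change s (Ideal.Quotient.mk _ f) = 0
    rw [Ideal.Quotient.eq_zero_iff_mem.mpr (Ideal.mem_span_singleton_self _), map_zero]
  have hex : ∀ i, ∃ c : MvPolynomial σ ℂ, t (X i) = q (X i) + q f * q c := by
    intro i
    have h1 := Ideal.Quotient.eq.mp (ht (X i))
    obtain ⟨c, hc⟩ := Ideal.mem_span_singleton'.mp h1
    obtain ⟨c, rfl⟩ := Ideal.Quotient.mk_surjective c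
    exact ⟨c, by rw [← sub_eq_iff_eq_add', ← hc, mul_comm]; rfl⟩
  choose c hc using hex
  have hff : q f * q f = 0 := by
    rw [← map_mul, ← pow_two]
    exact Ideal.Quotient.eq_zero_iff_mem.mpr (Ideal.mem_span_singleton_self _)
  -- First-order Taylor expansion of `p(X + f c)`, exact because `f² = 0` in `B`.
  have key : ∀ p, t p = q p + q f * q (∑ i, c i * pderiv i p) := by
    intro p
    induction p using MvPolynomial.induction_on with
    | C a =>
      rw [← MvPolynomial.algebraMap_eq]
      simp only [AlgHom.commutes, Derivation.map_algebraMap, mul_zero, Finset.sum_const_zero,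
        map_zero, add_zero]
    | add p r hp hr =>
      simp only [map_add, hp, hr, mul_add, Finset.sum_add_distrib]
      ring
    | mul_X p i hp =>
      have hsum : ∑ k, c k * pderiv k (p * X i) =
          X i * (∑ k, c k * pderiv k p) + p * c i := by
        simp only [Derivation.leibniz, smul_eq_mul, mul_add, Finset.sum_add_distrib,
          Finset.mul_sum]
        rw [add_comm]
        congr 1
        · exact Finset.sum_congr rfl fun k _ => by ring
        · rw [Finset.sum_eq_single i]
          · simp [mul_comm]
          · intro b _ hb
            simp [pderiv_X_of_ne hb.symm]
          · simp
      rw [map_mul, hp, hc, hsum]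
      simp only [map_mul, map_add]
      linear_combination (q (∑ i, c i * pderiv i p)) * q (c i) * hff
  have h0 := key f
  rw [htf, ← map_mul, ← map_add] at h0
  have h1 := Ideal.mem_span_singleton'.mp (Ideal.Quotient.eq_zero_iff_mem.mp h0.symm)
  obtain ⟨a, ha⟩ := h1
  -- The lift kills `f`, so `f (1 + ∑ c_i ∂_i f)` is a multiple of `f²`. After cancelling `f`,
  -- evaluation at a singular zero gives `1 = 0`.
  have h2 : 1 + ∑ i, c i * pderiv i f = a * f := by
    apply mul_left_cancel₀ hf
    rw [mul_add, mul_one, ← ha]; ring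
  have h3 := congrArg (eval z) h2
  simp [hcon, hz] at h3

/-! ### Integrality in the bigraded ring -/

/-- The bidegrees of the variables. -/
abbrev bidegreeWeight (n₁ n₂ : ℕ) : Fin n₁ ⊕ Fin n₂ → ℕ × ℕ :=
  Sum.elim (fun _ => ((1, 0) : ℕ × ℕ)) (fun _ => ((0, 1) : ℕ × ℕ))

theorem weight_bidegreeWeight {n₁ n₂ : ℕ} (d : Fin n₁ ⊕ Fin n₂ →₀ ℕ) :
    Finsupp.weight (bidegreeWeight n₁ n₂) d = (∑ i, d (Sum.inl i), ∑ j, d (Sum.inr j)) := by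
  rw [Finsupp.weight_apply, Finsupp.sum_fintype _ _ (by simp)]
  simp [Fintype.sum_sum_type, Prod.ext_iff, Prod.fst_sum, Prod.snd_sum]

open MvPolynomial in
attribute [local instance] MvPolynomial.weightedGradedAlgebra in
/-- Coefficients in a homogeneous ideal membership can be chosen homogeneous. -/
theorem exists_homogeneous_coeff_of_mem_sup {σ M ι : Type} [AddCancelCommMonoid M] [DecidableEq M]
    [Fintype ι] (w : σ → M) (I : Ideal (MvPolynomial σ ℂ))
    (hI : I.IsHomogeneous (weightedHomogeneousSubmodule ℂ w))
    {e D : M} (g : ι → MvPolynomial σ ℂ) (hg : ∀ i, (g i).IsWeightedHomogeneous w e)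
    {f : MvPolynomial σ ℂ} (hf : f.IsWeightedHomogeneous w (D + e))
    (hmem : f ∈ I ⊔ Ideal.span (Set.range g)) :
    ∃ b : ι → MvPolynomial σ ℂ, (∀ i, (b i).IsWeightedHomogeneous w D) ∧
      f - ∑ i, b i * g i ∈ I := by
  obtain ⟨a, ha, s, hs, hadd⟩ := Submodule.mem_sup.mp hmem
  obtain ⟨c, rfl⟩ := Ideal.mem_span_range_iff_exists_fun.mp hs
  refine ⟨fun i => weightedHomogeneousComponent w D (c i),
    fun i => weightedHomogeneousComponent_isWeightedHomogeneous _ _, ?_⟩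
  have hmul : ∀ i, weightedHomogeneousComponent w (D + e) (c i * g i) =
      weightedHomogeneousComponent w D (c i) * g i := by
    intro i
    have := DirectSum.coe_decompose_mul_add_of_right_mem (weightedHomogeneousSubmodule ℂ w)
      (i := D) (a := c i) (b := g i) (hg i)
    rw [← weightedDecomposition.decompose'_apply, ← weightedDecomposition.decompose'_apply]
    exact this
  have h1 := weightedHomogeneousComponent_mem_of_mem ℂ w hI ha (D + e)
  have h2 : weightedHomogeneousComponent w (D + e) f = f := hf.weightedHomogeneousComponent_same
  rw [← hadd, map_add, map_sum, hadd] at h2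
  simp_rw [hmul] at h2
  rw [← h2, add_sub_cancel_right]
  exact h1

section

variable {n₁ n₂ : ℕ}

open MvPolynomial

/-- Monomials of high degree in both groups of variables lie in an ideal that contains powers of
all products `x_i y_j`. -/
theorem exists_forall_monomial_mem (J : Ideal (BiPoly n₁ n₂))
    (hJ : ∀ i j, (X (Sum.inl i) * X (Sum.inr j) : BiPoly n₁ n₂) ∈ J.radical)
    {e : ℕ × ℕ} (he₁ : 0 < e.1) (he₂ : 0 < e.2) :
    ∃ K : ℕ, 0 < K ∧ ∀ k, K ≤ k → ∀ d, Finsupp.weight (bidegreeWeight n₁ n₂) d = k • e →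
      ∀ a : ℂ, monomial d a ∈ J := by
  choose N hN using hJ
  let M := ∑ i, ∑ j, N i j
  have hM : ∀ i j, (X (Sum.inl i) * X (Sum.inr j) : BiPoly n₁ n₂) ^ M ∈ J := by
    intro i j
    refine J.pow_mem_of_pow_mem (hN i j) ?_
    exact (Finset.single_le_sum (f := fun j => N i j) (fun _ _ => Nat.zero_le _)
      (Finset.mem_univ j)).trans (Finset.single_le_sum (f := fun i => ∑ j, N i j)
      (fun _ _ => Nat.zero_le _) (Finset.mem_univ i))
  -- Pigeonhole: from this degree on, some `x_i` and some `y_j` both have exponent at least `M`.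
  refine ⟨n₁ * M + n₂ * M + 1, Nat.succ_pos _, ?_⟩
  intro k hk d hd a
  rw [weight_bidegreeWeight, Prod.ext_iff] at hd
  simp only [Prod.smul_fst, Prod.smul_snd, smul_eq_mul] at hd
  obtain ⟨hd₁, hd₂⟩ := hd
  have hk₁ : k ≤ k * e.1 := Nat.le_mul_of_pos_right _ he₁
  have hk₂ : k ≤ k * e.2 := Nat.le_mul_of_pos_right _ he₂
  obtain ⟨i, hi⟩ : ∃ i, M ≤ d (Sum.inl i) := by
    by_contra! h
    have : ∑ i, d (Sum.inl i) ≤ ∑ i : Fin n₁, M := Finset.sum_le_sum fun i _ => (h i).le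
    simp only [Finset.sum_const, Finset.card_univ, Fintype.card_fin, smul_eq_mul] at this
    omega
  obtain ⟨j, hj⟩ : ∃ j, M ≤ d (Sum.inr j) := by
    by_contra! h
    have : ∑ j, d (Sum.inr j) ≤ ∑ j : Fin n₂, M := Finset.sum_le_sum fun i _ => (h i).le
    simp only [Finset.sum_const, Finset.card_univ, Fintype.card_fin, smul_eq_mul] at this
    omega
  have hdvd : (X (Sum.inl i) * X (Sum.inr j) : BiPoly n₁ n₂) ^ M ∣ monomial d a := by
    have hle : Finsupp.single (Sum.inl i) M + Finsupp.single (Sum.inr j) M ≤ d := by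
      classical
      intro l
      simp only [Finsupp.add_apply, Finsupp.single_apply]
      rcases l with l | l
      · by_cases h : i = l
        · subst h; simpa using hi
        · simp [h]
      · by_cases h : j = l
        · subst h; simpa using hj
        · simp [h]
    rw [mul_pow, X_pow_eq_monomial, X_pow_eq_monomial, monomial_mul, one_mul]
    exact monomial_dvd_monomial.mpr ⟨Or.inr hle, one_dvd _⟩
  exact J.mem_of_dvd hdvd (hM i j)

theorem finite_setOf_weight_bidegreeWeight_eq (e : ℕ × ℕ) (K : ℕ) :
    {d : Fin n₁ ⊕ Fin n₂ →₀ ℕ |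
      ∃ k < K, Finsupp.weight (bidegreeWeight n₁ n₂) d = k • e}.Finite := by
  refine (Set.finite_Iic (Finsupp.equivFunOnFinite.symm
    (fun _ : Fin n₁ ⊕ Fin n₂ => K * (e.1 + e.2)))).subset ?_
  rintro d ⟨k, hk, hd⟩ l
  rw [weight_bidegreeWeight, Prod.ext_iff] at hd
  simp only [Prod.smul_fst, Prod.smul_snd, smul_eq_mul] at hd
  have h₁ : k * e.1 ≤ K * (e.1 + e.2) := Nat.mul_le_mul hk.le (Nat.le_add_right _ _)
  have h₂ : k * e.2 ≤ K * (e.1 + e.2) := Nat.mul_le_mul hk.le (Nat.le_add_left _ _)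
  change d l ≤ K * (e.1 + e.2)
  rcases l with i | j
  · exact (Finset.single_le_sum (f := fun i => d (Sum.inl i)) (fun _ _ => Nat.zero_le _)
      (Finset.mem_univ i)).trans (hd.1.le.trans h₁)
  · exact (Finset.single_le_sum (f := fun i => d (Sum.inr i)) (fun _ _ => Nat.zero_le _)
      (Finset.mem_univ j)).trans (hd.2.le.trans h₂)

/-- If bihomogeneous forms `g` of bidegree `e` (both entries positive) have no common zero with
`x ≠ 0`, `y ≠ 0` on the zero locus of the bihomogeneous ideal `I`, then modulo `I` all forms of
bidegree `e` are integral over every subalgebra containing the `g i`. -/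
theorem isIntegral_of_bihomogeneous {ι Q : Type} [Fintype ι] [CommRing Q] [IsDomain Q]
    [Algebra ℂ Q] (π : BiPoly n₁ n₂ →ₐ[ℂ] Q) (I : Ideal (BiPoly n₁ n₂))
    (hI : letI := weightedGradedAlgebra ℂ (bidegreeWeight n₁ n₂)
      I.IsHomogeneous (weightedHomogeneousSubmodule ℂ (bidegreeWeight n₁ n₂)))
    (hπ : ∀ f ∈ I, π f = 0) {e : ℕ × ℕ} (he₁ : 0 < e.1) (he₂ : 0 < e.2)
    (g : ι → BiPoly n₁ n₂) (hg : ∀ i, (g i).IsWeightedHomogeneous (bidegreeWeight n₁ n₂) e)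
    (hrad : ∀ i j, (X (Sum.inl i) * X (Sum.inr j) : BiPoly n₁ n₂) ∈
      (I ⊔ Ideal.span (Set.range g)).radical)
    (A : Subalgebra ℂ Q) (hA : ∀ i, π (g i) ∈ A)
    {f : BiPoly n₁ n₂} (hf : f.IsWeightedHomogeneous (bidegreeWeight n₁ n₂) e) :
    IsIntegral A (π f) := by
  obtain ⟨K, hK, hmon⟩ := exists_forall_monomial_mem _ hrad he₁ he₂
  let T : Set (Fin n₁ ⊕ Fin n₂ →₀ ℕ) :=
    {d | ∃ k < K, Finsupp.weight (bidegreeWeight n₁ n₂) d = k • e}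
  -- Determinant trick: `N` is finitely generated and nonzero, and it absorbs all forms of bidegree
  -- `k • e`, since for `k ≥ K` these reduce modulo `I` to combinations of the `g i`. Multiplication
  -- by `π f` therefore preserves `N`.
  let N : Submodule A Q := Submodule.span A ((fun d => π (monomial d 1)) '' T)
  have hNfg : N.FG :=
    Submodule.fg_span ((finite_setOf_weight_bidegreeWeight_eq e K).image _)
  have hmem : ∀ k : ℕ, ∀ p : BiPoly n₁ n₂,
      p.IsWeightedHomogeneous (bidegreeWeight n₁ n₂) (k • e) → π p ∈ N := by
    intro k
    induction k using Nat.strong_induction_on with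
    | _ k ih =>
      intro p hp
      by_cases hkK : k < K
      · rw [p.as_sum, map_sum]
        refine N.sum_mem fun d hd => ?_
        have : monomial d (coeff d p) = coeff d p • (monomial d 1 : BiPoly n₁ n₂) := by
          rw [smul_monomial, smul_eq_mul, mul_one]
        rw [this, map_smul]
        exact Submodule.smul_of_tower_mem N _
          (Submodule.subset_span ⟨d, ⟨k, hkK, hp (mem_support_iff.mp hd)⟩, rfl⟩)
      · push Not at hkK
        obtain ⟨k, rfl⟩ : ∃ l, k = l + 1 := ⟨k - 1, by omega⟩
        have hpJ : p ∈ I ⊔ Ideal.span (Set.range g) := by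
          rw [p.as_sum]
          exact Ideal.sum_mem _ fun d hd => hmon _ hkK d (hp (mem_support_iff.mp hd)) _
        rw [succ_nsmul] at hp
        obtain ⟨b, hb, hbI⟩ := exists_homogeneous_coeff_of_mem_sup _ I hI g hg hp hpJ
        have hpb := hπ _ hbI
        rw [map_sub, sub_eq_zero, map_sum] at hpb
        rw [hpb]
        refine N.sum_mem fun i _ => ?_
        rw [map_mul, mul_comm]
        exact N.smul_mem (⟨π (g i), hA i⟩ : A)
          (ih k (Nat.lt_succ_self k) (b i) (hb i))
  have hone : (1 : Q) ∈ N := by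
    have := hmem 0 1 (by rw [zero_nsmul]; exact isWeightedHomogeneous_one _ _)
    rwa [map_one] at this
  refine isIntegral_of_smul_mem_submodule (M := Q) N ?_ hNfg _ ?_
  · intro h
    rw [h, Submodule.mem_bot] at hone
    exact one_ne_zero hone
  · intro m hm
    induction hm using Submodule.span_induction with
    | mem x hx =>
      obtain ⟨d, ⟨k, -, hd⟩, rfl⟩ := hx
      change π f * π (monomial d 1) ∈ N
      rw [← map_mul]
      refine hmem (k + 1) _ ?_
      rw [succ_nsmul']
      exact hf.mul (isWeightedHomogeneous_monomial _ _ _ hd)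
    | zero => rw [smul_zero]; exact N.zero_mem
    | add x y _ _ hx hy => rw [smul_add]; exact N.add_mem hx hy
    | smul a x _ hx => rw [smul_comm]; exact N.smul_mem a hx

/-- Dimension bound for a domain quotient of the bigraded polynomial ring in which neither all `x_i`
nor all `y_j` vanish. -/
theorem ringKrullDim_le_of_bihomogeneous {ι Q : Type} [Fintype ι] [CommRing Q] [IsDomain Q]
    [Algebra ℂ Q] (π : BiPoly n₁ n₂ →ₐ[ℂ] Q) (hsurj : Function.Surjective π)
    (I : Ideal (BiPoly n₁ n₂))
    (hI : letI := weightedGradedAlgebra ℂ (bidegreeWeight n₁ n₂)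
      I.IsHomogeneous (weightedHomogeneousSubmodule ℂ (bidegreeWeight n₁ n₂)))
    (hπ : ∀ f ∈ I, π f = 0) {e : ℕ × ℕ} (he₁ : 0 < e.1) (he₂ : 0 < e.2)
    (g : ι → BiPoly n₁ n₂) (hg : ∀ i, (g i).IsWeightedHomogeneous (bidegreeWeight n₁ n₂) e)
    (hrad : ∀ i j, (X (Sum.inl i) * X (Sum.inr j) : BiPoly n₁ n₂) ∈
      (I ⊔ Ideal.span (Set.range g)).radical)
    {i₀ : Fin n₁} {j₀ : Fin n₂} (hx : π (X (Sum.inl i₀)) ≠ 0) (hy : π (X (Sum.inr j₀)) ≠ 0) :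
    ringKrullDim Q ≤ ((Fintype.card ι + 1 : ℕ) : WithBot ℕ∞) := by
  let v : Option ι → Q := fun o => o.elim (π (X (Sum.inl i₀))) fun i => π (g i)
  refine ringKrullDim_le_of_isAlgebraic_adjoin π hsurj (ι := Option ι) (by simp) v ?_
  have hv : ∀ o, v o ∈ Algebra.adjoin ℂ (Set.range v) :=
    fun o => Algebra.subset_adjoin ⟨o, rfl⟩
  generalize Algebra.adjoin ℂ (Set.range v) = A at hv ⊢
  have halg : ∀ f : BiPoly n₁ n₂, f.IsWeightedHomogeneous (bidegreeWeight n₁ n₂) e →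
      IsAlgebraic A (π f) := fun f hf =>
    (isIntegral_of_bihomogeneous π I hI hπ he₁ he₂ g hg hrad A (fun i => hv (some i))
      hf).isAlgebraic
  have hxalg : IsAlgebraic A (π (X (Sum.inl i₀))) :=
    isAlgebraic_algebraMap (⟨_, hv none⟩ : A)
  have hcancel : ∀ {y z : Q}, y ≠ 0 → IsAlgebraic A y → IsAlgebraic A (y * z) →
      IsAlgebraic A z := fun hy0 hya hyz =>
    IsAlgebraic.of_mul (mem_nonZeroDivisors_of_ne_zero hy0) hya hyz
  have hX : ∀ l, (X l : BiPoly n₁ n₂).IsWeightedHomogeneous (bidegreeWeight n₁ n₂)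
      (bidegreeWeight n₁ n₂ l) := fun l => isWeightedHomogeneous_X ℂ _ l
  obtain ⟨a, ha⟩ : ∃ a, e.1 = a + 1 := ⟨e.1 - 1, by omega⟩
  obtain ⟨b, hb⟩ : ∃ b, e.2 = b + 1 := ⟨e.2 - 1, by omega⟩
  -- The form `x_{i₀}^{a+1} y_{j₀}^b y_l` has bidegree `e`; cancel the algebraic factor in `x_{i₀}`.
  have hyl : ∀ l, IsAlgebraic A (π (X (Sum.inr j₀)) ^ b * π (X (Sum.inr l))) := by
    intro l
    refine hcancel (pow_ne_zero (a + 1) hx) (hxalg.pow _) ?_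
    rw [← map_pow, ← map_pow, ← map_mul, ← map_mul]
    refine halg _ ?_
    convert! ((hX (Sum.inl i₀)).pow (a + 1)).mul (((hX (Sum.inr j₀)).pow b).mul (hX (Sum.inr l)))
      using 1
    simp [Prod.ext_iff, ha, hb]
  have hyalg : IsAlgebraic A (π (X (Sum.inr j₀))) := by
    have h := hyl j₀
    rw [← pow_succ] at h
    exact h.of_pow (Nat.succ_pos b)
  rintro (k | l)
  · refine hcancel (pow_ne_zero a hx) (hxalg.pow _) ?_
    refine hcancel (pow_ne_zero (b + 1) hy) (hyalg.pow _) ?_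
    rw [← map_pow, ← map_pow, ← map_mul, ← map_mul]
    refine halg _ ?_
    convert! ((hX (Sum.inr j₀)).pow (b + 1)).mul (((hX (Sum.inl i₀)).pow a).mul (hX (Sum.inl k)))
      using 1
    simp [Prod.ext_iff, ha, hb]
  · exact hcancel (pow_ne_zero b hy) (hyalg.pow _) (hyl l)

end

/-! ### Charts, scaling and Euler's identity -/

section

variable {n₁ n₂ : ℕ}

open MvPolynomial

theorem eval_dehomogenize (i : Fin n₁) (j : Fin n₂) (w : Fin n₁ ⊕ Fin n₂ → ℂ)
    (hi : w (Sum.inl i) = 1) (hj : w (Sum.inr j) = 1) (F : BiPoly n₁ n₂) :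
    eval (fun c : ChartIndex i j => w (Sum.map Subtype.val Subtype.val c)) (dehomogenize i j F) =
      eval w F := by
  induction F using MvPolynomial.induction_on with
  | C a => simp [dehomogenize, algebraMap_eq]
  | add p q hp hq => simp only [map_add, hp, hq]
  | mul_X p l hp =>
    simp only [map_mul, hp, eval_X]
    congr 1
    rcases l with k | l
    · by_cases h : k = i
      · subst h; simp [dehomogenize, hi]
      · simp [dehomogenize, h]
    · by_cases h : l = j
      · subst h; simp [dehomogenize, hj]
      · simp [dehomogenize, h]

theorem pderiv_dehomogenize (i : Fin n₁) (j : Fin n₂) (c : ChartIndex i j) (F : BiPoly n₁ n₂) :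
    pderiv c (dehomogenize i j F) =
      dehomogenize i j (pderiv (Sum.map Subtype.val Subtype.val c) F) := by
  classical
  induction F using MvPolynomial.induction_on with
  | C a => simp [dehomogenize, algebraMap_eq]
  | add p q hp hq => simp only [map_add, hp, hq]
  | mul_X p l hp =>
    have hX : pderiv c (dehomogenize i j (X l)) =
        dehomogenize i j (pderiv (Sum.map Subtype.val Subtype.val c) (X l)) := by
      rw [pderiv_X]
      rcases l with k | l
      · by_cases h : k = i
        · subst h
          rcases c with ⟨c, hc⟩ | ⟨c, hc⟩ <;>
            simp [dehomogenize, Ne.symm hc]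
        · rcases c with ⟨c, hc⟩ | ⟨c, hc⟩ <;>
            simp [dehomogenize, Pi.single_apply, h, pderiv_X, apply_ite]
      · by_cases h : l = j
        · subst h
          rcases c with ⟨c, hc⟩ | ⟨c, hc⟩ <;>
            simp [dehomogenize, Ne.symm hc]
        · rcases c with ⟨c, hc⟩ | ⟨c, hc⟩ <;>
            simp [dehomogenize, Pi.single_apply, h, pderiv_X, apply_ite]
    simp only [map_mul, map_add, Derivation.leibniz, smul_eq_mul, hp, hX]

theorem eval_smul_of_isWeightedHomogeneous {p : BiPoly n₁ n₂} {e : ℕ × ℕ}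
    (hp : p.IsWeightedHomogeneous (bidegreeWeight n₁ n₂) e) (s t : ℂ)
    (z : Fin n₁ ⊕ Fin n₂ → ℂ) :
    eval (Sum.elim (fun i => s * z (Sum.inl i)) (fun j => t * z (Sum.inr j))) p =
      s ^ e.1 * t ^ e.2 * eval z p := by
  rw [eval_eq', eval_eq', Finset.mul_sum]
  refine Finset.sum_congr rfl fun d hd => ?_
  have h := hp (mem_support_iff.mp hd)
  rw [weight_bidegreeWeight, Prod.ext_iff] at h
  simp only at h
  simp only [Fintype.prod_sum_type, Sum.elim_inl, Sum.elim_inr, mul_pow, Finset.prod_mul_distrib,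
    Finset.prod_pow_eq_pow_sum, h.1, h.2]
  ring

/-- Scaling moves any point with `x_i y_j ≠ 0` into the chart, so a zero dehomogenization would make
`F x_i y_j` vanish everywhere. -/
theorem dehomogenize_ne_zero {F : BiPoly n₁ n₂} (hF : F ≠ 0) {e : ℕ × ℕ}
    (hp : F.IsWeightedHomogeneous (bidegreeWeight n₁ n₂) e) (i : Fin n₁) (j : Fin n₂) :
    dehomogenize i j F ≠ 0 := by
  intro h0
  have hprod : F * (X (Sum.inl i) * X (Sum.inr j)) = 0 := by
    refine MvPolynomial.funext fun z => ?_
    simp only [map_mul, eval_X, map_zero]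
    by_cases hi : z (Sum.inl i) = 0
    · simp [hi]
    by_cases hj : z (Sum.inr j) = 0
    · simp [hj]
    have h1 := eval_smul_of_isWeightedHomogeneous hp (z (Sum.inl i))⁻¹ (z (Sum.inr j))⁻¹ z
    rw [← eval_dehomogenize i j _ (by simp [hi]) (by simp [hj]), h0, map_zero] at h1
    have h2 : eval z F = 0 := by
      refine (mul_eq_zero.mp h1.symm).resolve_left ?_
      exact mul_ne_zero (pow_ne_zero _ (inv_ne_zero hi)) (pow_ne_zero _ (inv_ne_zero hj))
    rw [h2, zero_mul]
  exact mul_ne_zero hF (mul_ne_zero (X_ne_zero _) (X_ne_zero _)) hprod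

/-- Euler's identity in the `x`-variables alone: give `x` weight 1 and `y` weight 0. -/
theorem eval_eq_zero_of_pderiv_inl {F : BiPoly n₁ n₂} {e : ℕ × ℕ}
    (hp : F.IsWeightedHomogeneous (bidegreeWeight n₁ n₂) e) (he : e.1 ≠ 0)
    {z : Fin n₁ ⊕ Fin n₂ → ℂ} (hz : ∀ i, eval z (pderiv (Sum.inl i) F) = 0) : eval z F = 0 := by
  have hF : F.IsWeightedHomogeneous (Sum.elim (fun _ => 1) (fun _ => 0) : _ → ℕ) e.1 := by
    intro d hd
    have h := hp hd
    rw [weight_bidegreeWeight] at h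
    rw [Finsupp.weight_apply, Finsupp.sum_fintype _ _ (by simp), ← h]
    simp [Fintype.sum_sum_type]
  have h := congrArg (eval z) hF.sum_weight_X_mul_pderiv
  simp only [Fintype.sum_sum_type, Sum.elim_inl, Sum.elim_inr, one_smul, zero_smul,
    Finset.sum_const_zero, add_zero, map_sum, map_mul, hz, mul_zero, map_nsmul] at h
  exact (smul_eq_zero.mp h.symm).resolve_left he

/-- On a smooth biprojective hypersurface the partial derivatives have no common zero with both
`x ≠ 0` and `y ≠ 0`. -/
theorem eq_zero_or_eq_zero_of_isSmoothBiprojective {F : BiPoly n₁ n₂} (hF : F ≠ 0) {d₁ d₂ : ℕ}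
    (hd₁ : 2 ≤ d₁) (hd₂ : 2 ≤ d₂) (hbihom : IsBihomogeneous F d₁ d₂)
    (hsmooth : IsSmoothBiprojective F) {z : Fin n₁ ⊕ Fin n₂ → ℂ}
    (hz : ∀ l, eval z (pderiv l F) = 0) (i : Fin n₁) (j : Fin n₂) :
    z (Sum.inl i) = 0 ∨ z (Sum.inr j) = 0 := by
  by_contra! hne
  obtain ⟨hi, hj⟩ := hne
  let w : Fin n₁ ⊕ Fin n₂ → ℂ := Sum.elim (fun k => (z (Sum.inl i))⁻¹ * z (Sum.inl k))
    (fun k => (z (Sum.inr j))⁻¹ * z (Sum.inr k))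
  have hwi : w (Sum.inl i) = 1 := inv_mul_cancel₀ hi
  have hwj : w (Sum.inr j) = 1 := inv_mul_cancel₀ hj
  have hw : ∀ l, eval w (pderiv l F) = 0 := by
    rintro (k | k)
    · have := IsWeightedHomogeneous.pderiv (i := Sum.inl k) (n' := (d₁ - 1, d₂)) hbihom
        (by simp; omega)
      rw [eval_smul_of_isWeightedHomogeneous this, hz, mul_zero]
    · have := IsWeightedHomogeneous.pderiv (i := Sum.inr k) (n' := (d₁, d₂ - 1)) hbihom
        (by simp; omega)
      rw [eval_smul_of_isWeightedHomogeneous this, hz, mul_zero]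
  have hwF : eval w F = 0 :=
    eval_eq_zero_of_pderiv_inl hbihom (by simp; omega) fun k => hw (Sum.inl k)
  have := hsmooth i j
  obtain ⟨c, hc⟩ := exists_eval_pderiv_ne_zero_of_smooth _ (dehomogenize_ne_zero hF hbihom i j)
    (fun c : ChartIndex i j => w (Sum.map Subtype.val Subtype.val c))
    (by rw [eval_dehomogenize i j w hwi hwj, hwF])
  rw [pderiv_dehomogenize, eval_dehomogenize i j w hwi hwj] at hc
  exact hc (hw _)

/-! ### The dimension bound -/

/-- Dimension bound for a set on which bihomogeneous forms `h` vanish, when the common zeros of `h`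
and of forms `g` of bidegree `e` all have `x = 0` or `y = 0`. -/
theorem affineDim_le_of_bihomogeneous {ι κ : Type} [Fintype ι]
    (h : κ → BiPoly n₁ n₂) {eh e : ℕ × ℕ}
    (hh : ∀ k, (h k).IsWeightedHomogeneous (bidegreeWeight n₁ n₂) eh)
    (he₁ : 0 < e.1) (he₂ : 0 < e.2) (g : ι → BiPoly n₁ n₂)
    (hg : ∀ i, (g i).IsWeightedHomogeneous (bidegreeWeight n₁ n₂) e)
    (hzero : ∀ z, (∀ k, eval z (h k) = 0) → (∀ i, eval z (g i) = 0) →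
      ∀ i j, z (Sum.inl i) = 0 ∨ z (Sum.inr j) = 0)
    (V : Set (Fin n₁ ⊕ Fin n₂ → ℂ)) (hV : ∀ z ∈ V, ∀ k, eval z (h k) = 0) :
    affineDim V ≤ ((max (max n₁ n₂) (Fintype.card ι + 1) : ℕ) : WithBot ℕ∞) := by
  refine ringKrullDim_quotient_le_of_forall_isPrime _ _ fun P hP hVP => ?_
  let π : BiPoly n₁ n₂ →ₐ[ℂ] BiPoly n₁ n₂ ⧸ P := Ideal.Quotient.mkₐ ℂ P
  have hsurj : Function.Surjective π := Ideal.Quotient.mkₐ_surjective ℂ P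
  have hmono : ∀ {a : ℕ}, a ≤ max (max n₁ n₂) (Fintype.card ι + 1) →
      ringKrullDim (BiPoly n₁ n₂ ⧸ P) ≤ (a : WithBot ℕ∞) →
      ringKrullDim (BiPoly n₁ n₂ ⧸ P) ≤
        ((max (max n₁ n₂) (Fintype.card ι + 1) : ℕ) : WithBot ℕ∞) :=
    fun ha hle => hle.trans (by exact_mod_cast ha)
  by_cases hx : ∀ i, π (X (Sum.inl i)) = 0
  · refine hmono ((le_max_right _ _).trans (le_max_left _ _))
      (ringKrullDim_le_of_isAlgebraic_adjoin π hsurj (ι := Fin n₂) (by simp)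
        (fun j => π (X (Sum.inr j))) ?_)
    rintro (i | j)
    · rw [hx]; exact isAlgebraic_zero
    · exact isAlgebraic_algebraMap (⟨_, Algebra.subset_adjoin ⟨j, rfl⟩⟩ :
        Algebra.adjoin ℂ (Set.range fun j => π (X (Sum.inr j))))
  by_cases hy : ∀ j, π (X (Sum.inr j)) = 0
  · refine hmono ((le_max_left _ _).trans (le_max_left _ _))
      (ringKrullDim_le_of_isAlgebraic_adjoin π hsurj (ι := Fin n₁) (by simp)
        (fun i => π (X (Sum.inl i))) ?_)
    rintro (i | j)
    · exact isAlgebraic_algebraMap (⟨_, Algebra.subset_adjoin ⟨i, rfl⟩⟩ :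
        Algebra.adjoin ℂ (Set.range fun i => π (X (Sum.inl i))))
    · rw [hy]; exact isAlgebraic_zero
  push Not at hx hy
  obtain ⟨i₀, hi₀⟩ := hx
  obtain ⟨j₀, hj₀⟩ := hy
  -- `P` need not be bihomogeneous: the graded argument runs modulo the ideal generated by `h`,
  -- which `P` contains.
  refine hmono (le_max_right _ _) (ringKrullDim_le_of_bihomogeneous π hsurj
    (Ideal.span (Set.range h)) ?_ ?_ he₁ he₂ g hg ?_ hi₀ hj₀)
  · let := weightedGradedAlgebra ℂ (bidegreeWeight n₁ n₂)
    refine Ideal.homogeneous_span _ _ ?_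
    rintro _ ⟨k, rfl⟩
    exact ⟨eh, hh k⟩
  · intro f hf
    refine Ideal.Quotient.eq_zero_iff_mem.mpr (hVP ?_)
    refine (Ideal.span_le.mpr ?_ : Ideal.span (Set.range h) ≤ _) hf
    rintro _ ⟨k, rfl⟩ z hz
    rw [← hV z hz k, aeval_eq_eval]
  · intro i j
    rw [← vanishingIdeal_zeroLocus_eq_radical (K := ℂ)]
    intro z hz
    have hz' : ∀ p ∈ Ideal.span (Set.range h) ⊔ Ideal.span (Set.range g), eval z p = 0 :=
      fun p hp => by
        have := hz p hp
        rwa [aeval_eq_eval] at this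
    have hor := hzero z
      (fun k => hz' _ (Ideal.mem_sup_left (Ideal.subset_span ⟨k, rfl⟩)))
      (fun k => hz' _ (Ideal.mem_sup_right (Ideal.subset_span ⟨k, rfl⟩))) i j
    rw [map_mul, aeval_X, aeval_X]
    exact mul_eq_zero.mpr hor

theorem eq_zero_of_rank_lt_one {m : ℕ} {A : Matrix (Fin 1) (Fin m) ℂ} (hA : A.rank < 1) :
    A = 0 := by
  rw [Nat.lt_one_iff, Matrix.rank, Submodule.finrank_eq_zero, LinearMap.range_eq_bot] at hA
  ext i j
  have h := congrFun (LinearMap.congr_fun hA (Pi.single j 1)) i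
  simpa using h

end

theorem lemma2p2 (n₁ n₂ d₁ d₂ : ℕ) (hn₁ : 0 < n₁) (hn₂ : 0 < n₂)
    (hd₁ : 2 ≤ d₁) (hd₂ : 2 ≤ d₂)
    (F : BiPoly n₁ n₂) (hF : F ≠ 0) (hbihom : IsBihomogeneous F d₁ d₂)
    (hsmooth : IsSmoothBiprojective F) :
    affineDim (V₁star (fun _ : Fin 1 => F)) ≤
        ((max (max n₁ n₂) (n₁ + n₂ - n₁ + 1) : ℕ) : WithBot ℕ∞) ∧
      affineDim (V₂star (fun _ : Fin 1 => F)) ≤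
        ((max (max n₁ n₂) (n₁ + n₂ - n₂ + 1) : ℕ) : WithBot ℕ∞) := by
  have hx : ∀ i, (MvPolynomial.pderiv (Sum.inl i) F).IsWeightedHomogeneous
      (bidegreeWeight n₁ n₂) (d₁ - 1, d₂) := fun i =>
    MvPolynomial.IsWeightedHomogeneous.pderiv hbihom (by simp; omega)
  have hy : ∀ j, (MvPolynomial.pderiv (Sum.inr j) F).IsWeightedHomogeneous
      (bidegreeWeight n₁ n₂) (d₁, d₂ - 1) := fun j =>
    MvPolynomial.IsWeightedHomogeneous.pderiv hbihom (by simp; omega)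
  rw [Nat.add_sub_cancel_left, Nat.add_sub_cancel]
  constructor
  · have h := affineDim_le_of_bihomogeneous _ hx (by simp; omega) (by simp; omega) _ hy
      (fun z h₁ h₂ => eq_zero_or_eq_zero_of_isSmoothBiprojective hF hd₁ hd₂ hbihom hsmooth
        (Sum.rec h₁ h₂)) (V₁star (fun _ : Fin 1 => F))
      (fun z hz k => congrFun (congrFun (eq_zero_of_rank_lt_one hz) 0) k)
    rwa [Fintype.card_fin] at h
  · have h := affineDim_le_of_bihomogeneous _ hy (by simp; omega) (by simp; omega) _ hx
      (fun z h₂ h₁ => eq_zero_or_eq_zero_of_isSmoothBiprojective hF hd₁ hd₂ hbihom hsmooth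
        (Sum.rec h₁ h₂)) (V₂star (fun _ : Fin 1 => F))
      (fun z hz k => congrFun (congrFun (eq_zero_of_rank_lt_one hz) 0) k)
    rwa [Fintype.card_fin] at h
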